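/- \textbf{Setting.} Let $\lambda,\mu_1,\mu_2,\widetilde\mu>0$ and $p_r,p_g\in[0,1]$. Consider the two-queue load-balancing system with states $x=(x_1,x_2)\in\mathbb Z_+^2$ and actions $a\in\{r,g\}$ (red, green). Jobs arrive at rate $\lambda$, and under action $a$ an arriving job joins Queue 1 with probability $p_a$ and Queue 2 with probability $1-p_a$. If both queues are nonempty, jobs leave Queue $i$ at rate $\mu_i$; if exactly one queue is nonempty, jobs leave it at rate $\widetilde\mu$. Let $p(y\mid x,a)$ be the transition probabilities of the embedded discrete-time chain (rate of the transition divided by the total rate out of $x$). \textbf{Model 1.} For a probability measure $\mu$ on $\{\pm e_1,\pm e_2\}$ let $d(\mu)=(\mu(e_1)-\mu(-e_1),\mu(e_2)-\mu(-e_2))$. Transition probabilities $p(\cdot\mid\cdot,a)$, $a\in\{r,g\}$, on $\mathbb Z_+^2$ satisfy the conditions of Model 1 if: (i) for each $a$ there are probability measures $\mu_a,\mu_a',\mu_a''$ on $\{\pm e_1,\pm e_2\}$ such that $p(x+\xi\mid x,a)$, $\xi\in\{\pm e_1,\pm e_2\}$, equals $\mu_a(\xi)$ if $x_1,x_2>0$,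 $\mu_a'(\xi)$ if $x_1>0,x_2=0$, and $\mu_a''(\xi)$ if $x_1=0,x_2>0$, and $p(e_1\mid 0,a)+p(e_2\mid 0,a)=1$; (ii) with $d_a,d_a',d_a''$ the drifts of $\mu_a,\mu_a',\mu_a''$, there is $v\in\mathbb R_+^2$ with $\langle w,v\rangle<0$ for $w=d_g,d_g',d_g''$; (iii) there are a unit vector $l\in\mathbb R^2$ with $\varrho:=\min\{\langle d_r,l\rangle,\langle d_g,l\rangle\}>0$ and numbers $0<\alpha_0<\alpha_1\le1$ with $\delta d_r+(1-\delta)d_g\in\mathbb R_+^2$ for all $\delta\in(\alpha_0,\alpha_1)$ and $1-\alpha_1<\varrho-\alpha_0$. \textbf{Stability and transience.} Let $\tau_U=\inf\{n\ge1:X_n\in U\}$. A Markov chain $(X_n)$ on $\mathbb Z_+^2$ is irreducible if $\mathbb P(\tau_U<\infty\mid X_0=x_0)>0$ for every bounded nonempty $U$ and every $x_0\notin U$. It is transient if it is irreducible and for every bounded $U$ there is $x_0\notin U$ with $\mathbb P(\tau_U=\infty\mid X_0=x_0)>0$. It is stable (positive recurrent) if it is irreducible and $\mathbb E(\tau_U\mid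 X_0=x_0)<\infty$ for every bounded nonempty $U$ and every $x_0\notin U$. \textbf{Lemma.} Assume $$\mu_1<\lambda p_r,\qquad \mu_2<\lambda(1-p_r),\tag{1}$$ $$\mu_1<\lambda p_g,\qquad \mu_2>\lambda(1-p_g),\tag{2}$$ $$\widetilde\mu>\lambda\,\frac{(\mu_1+\mu_2)p_g-\mu_1}{\mu_2-\lambda(1-p_g)}.\tag{3}$$ Then: (a) if moreover $$\mu_2<\frac{\lambda(\lambda p_r-\mu_1)(p_g-p_r)}{\lambda+\mu_1+\mu_2}+\lambda(1-p_g),\tag{4}$$ then the embedded transition probabilities satisfy the conditions of Model 1; (b) if moreover $p_g<1$, the Markov chain obtained by always applying action $g$ is stable; (c) the Markov chain obtained by always applying action $r$ is transient. -/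

import Mathlib

open MeasureTheory ProbabilityTheory Set
open scoped ENNReal BigOperators

namespace LoadBalancing

/-- The two actions of the agent. -/
inductive Action
  | red
  | green

/-- The state space, the integer points of the closed positive quadrant. -/
abbrev State := ℕ × ℕ

/-- The four unit steps `e₁, -e₁, e₂, -e₂`. -/
inductive Step
  | e1
  | ne1
  | e2
  | ne2
  deriving DecidableEq

instance : Fintype Step where
  elems := {.e1, .ne1, .e2, .ne2}
  complete ξ := by cases ξ <;> simp

/-- A step as a vector of the integer grid. -/
def Step.vec : Step → ℤ × ℤ
  | .e1 => (1, 0)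
  | .ne1 => (-1, 0)
  | .e2 => (0, 1)
  | .ne2 => (0, -1)

/-- The inclusion of the state space in the integer grid. -/
def State.toGrid (x : State) : ℤ × ℤ := ((x.1 : ℤ), (x.2 : ℤ))

/-! ## Markov chains on the state space -/

/-- One-step transition kernel given by transition probabilities `p x y`. -/
noncomputable def stepKernel (p : State → PMF State) : Kernel State State where
  toFun x := (p x).toMeasure
  measurable' := measurable_of_countable _

instance (p : State → PMF State) : IsMarkovKernel (stepKernel p) :=
  ⟨fun x => PMF.toMeasure.isProbabilityMeasure (p x)⟩

/-- The kernel giving the law of `X (n+1)` from the history up to time `n`: only the present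
state matters. -/
noncomputable def historyKernel (p : State → PMF State) (n : ℕ) :
    Kernel ((i : Finset.Iic n) → (fun _ : ℕ => State) i) State :=
  (stepKernel p).comap (fun h => h ⟨n, Finset.mem_Iic.2 le_rfl⟩) (measurable_pi_apply _)

instance (p : State → PMF State) (n : ℕ) : IsMarkovKernel (historyKernel p n) := by
  unfold historyKernel; infer_instance

/-- The law, on the space of trajectories, of the Markov chain `(X n)` with transition
probabilities `p` started from `X 0 = x`. Under it, `X n` is the evaluation `ω ↦ ω n`. -/
noncomputable def chainLaw (p : State → PMF State) (x : State) : Measure (ℕ → State) :=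
  Kernel.traj (X := fun _ : ℕ => State) (historyKernel p) 0 (fun _ => x)

/-- `inf {n ≥ 1 : X n ∈ U}`, equal to `⊤` if there is no such `n`. -/
noncomputable def hitTime (U : Set State) (ω : ℕ → State) : ℕ∞ :=
  sInf ((fun n : ℕ => (n : ℕ∞)) '' {n : ℕ | 1 ≤ n ∧ ω n ∈ U})

/-- Every nonempty bounded set is reached with positive probability from every state
outside it. -/
def IsIrreducible (p : State → PMF State) : Prop :=
  ∀ U : Set State, Bornology.IsBounded U → U.Nonempty → ∀ x, x ∉ U →
    0 < chainLaw p x {ω | hitTime U ω < ⊤}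

/-- Transience (instability). -/
def IsTransient (p : State → PMF State) : Prop :=
  IsIrreducible p ∧
    ∀ U : Set State, Bornology.IsBounded U → ∃ x, x ∉ U ∧
      0 < chainLaw p x {ω | hitTime U ω = ⊤}

/-- Positive recurrence (stability). -/
def IsStable (p : State → PMF State) : Prop :=
  IsIrreducible p ∧
    ∀ U : Set State, Bornology.IsBounded U → U.Nonempty → ∀ x, x ∉ U →
      ∫⁻ ω, (hitTime U ω : ℝ≥0∞) ∂(chainLaw p x) < ⊤

/-! ## The queueing model -/

/-- The drift `d(μ)` of a probability measure on the four unit steps. -/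
noncomputable def drift (μ : PMF Step) : EuclideanSpace ℝ (Fin 2) :=
  !₂[(μ .e1).toReal - (μ .ne1).toReal, (μ .e2).toReal - (μ .ne2).toReal]

/-- The closed positive orthant of the plane. -/
def posOrthant : Set (EuclideanSpace ℝ (Fin 2)) := {v | 0 ≤ v 0 ∧ 0 ≤ v 1}

/-- The probability of moving from the state `x` to the grid point `x + ξ` (which is `0` if that
point is not a state). -/
noncomputable def stepProb (p : Action → State → PMF State) (a : Action) (x : State) (ξ : Step) :
    ℝ≥0∞ :=
  (p a x).map State.toGrid (x.toGrid + ξ.vec)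

/-- The conditions of the queueing model on the transition probabilities `p`. The measures
`μ a`, `μ' a`, `μ'' a` are those used at interior points, on the positive first axis and on the
positive second axis. -/
def IsQueueingModel (p : Action → State → PMF State) : Prop :=
  ∃ μ μ' μ'' : Action → PMF Step,
    (∀ a x ξ, 0 < x.1 → 0 < x.2 → stepProb p a x ξ = μ a ξ) ∧
    (∀ a x ξ, 0 < x.1 → x.2 = 0 → stepProb p a x ξ = μ' a ξ) ∧
    (∀ a x ξ, x.1 = 0 → 0 < x.2 → stepProb p a x ξ = μ'' a ξ) ∧
    (∀ a, stepProb p a (0, 0) .e1 + stepProb p a (0, 0) .e2 = 1) ∧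
    (∃ v ∈ posOrthant, inner ℝ (drift (μ .green)) v < 0 ∧
      inner ℝ (drift (μ' .green)) v < 0 ∧ inner ℝ (drift (μ'' .green)) v < 0) ∧
    ∃ (l : EuclideanSpace ℝ (Fin 2)) (ϱ : ℝ), ‖l‖ = 1 ∧
      ϱ = min (inner ℝ (drift (μ .red)) l) (inner ℝ (drift (μ .green)) l) ∧ 0 < ϱ ∧
      ∃ α₀ α₁ : ℝ, 0 < α₀ ∧ α₀ < α₁ ∧ α₁ ≤ 1 ∧
        (∀ δ ∈ Ioo α₀ α₁, δ • drift (μ .red) + (1 - δ) • drift (μ .green) ∈ posOrthant) ∧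
        1 - α₁ < ϱ - α₀

/-! ## The load-balancing example -/

/-- Parameters of the two-queue system: arrival rate `lam`, service rates `mu1`, `mu2` when both
queues are busy, service rate `muT` of the busy queue when the other one is empty, and the
probability `prob a` that an arriving job is sent to the first queue under action `a`. -/
structure Params where
  lam : ℝ
  mu1 : ℝ
  mu2 : ℝ
  muT : ℝ
  prob : Action → ℝ
  lam_pos : 0 < lam
  mu1_pos : 0 < mu1
  mu2_pos : 0 < mu2
  muT_pos : 0 < muT
  prob_nonneg : ∀ a, 0 ≤ prob a
  prob_le_one : ∀ a, prob a ≤ 1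

/-- The rates of the continuous-time chain: the rate at which the system in state `x` makes the
step `ξ` under action `a`. -/
noncomputable def Params.rate (L : Params) (a : Action) (x : State) : Step → ℝ
  | .e1 => L.lam * L.prob a
  | .e2 => L.lam * (1 - L.prob a)
  | .ne1 => if x.1 = 0 then 0 else if x.2 = 0 then L.muT else L.mu1
  | .ne2 => if x.2 = 0 then 0 else if x.1 = 0 then L.muT else L.mu2

/-- The total rate at which the system leaves the state `x`. -/
noncomputable def Params.totalRate (L : Params) (a : Action) (x : State) : ℝ :=
  ∑ ξ : Step, L.rate a x ξ

theorem Params.rate_nonneg (L : Params) (a : Action) (x : State) (ξ : Step) :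
    0 ≤ L.rate a x ξ := by
  have h1 := L.lam_pos
  have h2 := L.mu1_pos
  have h3 := L.mu2_pos
  have h4 := L.muT_pos
  have h5 := L.prob_nonneg a
  have h6 := L.prob_le_one a
  cases ξ
  · exact mul_nonneg h1.le h5
  · simp only [Params.rate]; split_ifs <;> linarith
  · exact mul_nonneg h1.le (by linarith)
  · simp only [Params.rate]; split_ifs <;> linarith

theorem Step.sum_eq {M : Type*} [AddCommMonoid M] (f : Step → M) :
    ∑ ξ : Step, f ξ = f .e1 + (f .ne1 + (f .e2 + f .ne2)) := by
  have : (Finset.univ : Finset Step) = {.e1, .ne1, .e2, .ne2} := rfl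
  simp [this]

theorem Params.totalRate_pos (L : Params) (a : Action) (x : State) : 0 < L.totalRate a x := by
  have h1 := L.lam_pos
  have h2 := L.rate_nonneg a x .ne1
  have h3 := L.rate_nonneg a x .ne2
  have h4 : L.rate a x .e1 + L.rate a x .e2 = L.lam := by simp only [Params.rate]; ring
  unfold Params.totalRate
  rw [Step.sum_eq]
  linarith

/-- The law of the step made by the embedded chain: the probability of each step, given that a
transition occurs, is its rate divided by the total rate. -/
noncomputable def Params.jumpLaw (L : Params) (a : Action) (x : State) : PMF Step :=
  PMF.ofFintype (fun ξ => ENNReal.ofReal (L.rate a x ξ / L.totalRate a x)) (by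
    rw [← ENNReal.ofReal_sum_of_nonneg
      (fun ξ _ => div_nonneg (L.rate_nonneg a x ξ) (L.totalRate_pos a x).le), ← Finset.sum_div]
    change ENNReal.ofReal (L.totalRate a x / L.totalRate a x) = 1
    rw [div_self (L.totalRate_pos a x).ne', ENNReal.ofReal_one])

/-- The state reached from `x` by a step. Downward steps from an empty queue have rate `0`, so
the truncation of the subtraction plays no role. -/
def move (x : State) : Step → State
  | .e1 => (x.1 + 1, x.2)
  | .ne1 => (x.1 - 1, x.2)
  | .e2 => (x.1, x.2 + 1)
  | .ne2 => (x.1, x.2 - 1)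

/-- The transition probabilities of the embedded discrete-time chain under each action. -/
noncomputable def Params.transition (L : Params) (a : Action) (x : State) : PMF State :=
  (L.jumpLaw a x).map (move x)

end LoadBalancing

namespace LoadBalancing

/-! ### One-step conditioning for the law of the chain -/

/-! The probabilistic input is one supermartingale inequality, `lyapunov_bound`. With the constant
`m = 0` it bounds the expected time to hit `D` (Foster's criterion); with `c = 0` and `m = 1` it
bounds the probability of ever hitting `D`. Drifts are computed with the continuous-time rates
(`Params.gen`); the embedded chain's mean increment is the generator divided by the total rate,
which is bounded above uniformly.

Red pushes both coordinates up in the interior, so `s ^ x₁ + s ^ x₂` is superharmonic there for `s <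
1` close to `1`. It is small deep inside the quadrant and large near the axes, which gives
transience.

For green, the linear function `x₁ + b x₂` has negative drift off the origin. Its interior drift
vanishes at `b₀ = (λ p_g - μ₁) / (μ₂ - λ (1 - p_g))`, and hypothesis (3) says exactly that the drift
on the first axis is negative for `b = b₀`; a slightly larger `b` serves everywhere
(`Params.exists_slope`). Stability, however, concerns hitting an arbitrary bounded set, possibly one
missing the origin. Subtracting a multiple of `boxPow`, which is subharmonic except at a chosen
target `u`, repairs the drift at the origin, so Foster's criterion applies directly with `D = {u}`.

The Model 1 conditions reuse the slope vector `(1, b)`; with `l = e₁` and `α₁ = 1`, inequality (4)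
becomes `α₀ < ϱ`. -/

instance (p : State → PMF State) (x : State) : IsProbabilityMeasure (chainLaw p x) := by
  unfold chainLaw; infer_instance

/-- The Markov property: the joint law of the history up to `n` and the next state is a
composition-product with `historyKernel`. The weight `g` lets one condition on the whole past, in
particular on not yet having met `D`. -/
theorem lintegral_chainLaw_succ (p : State → PMF State) (x : State) (n : ℕ)
    {g : ((i : Finset.Iic n) → (fun _ : ℕ => State) i) → ℝ≥0∞} (hg : Measurable g)
    (f : State → ℝ≥0∞) :
    ∫⁻ ω, g (Preorder.frestrictLe n ω) * f (ω (n + 1)) ∂chainLaw p x =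
      ∫⁻ ω, g (Preorder.frestrictLe n ω) * ∫⁻ y, f y ∂(p (ω n)).toMeasure ∂chainLaw p x := by
  have hf : Measurable f := measurable_of_countable f
  have hF : Measurable fun z : ((i : Finset.Iic n) → (fun _ : ℕ => State) i) × State =>
      g z.1 * f z.2 := (hg.comp measurable_fst).mul (hf.comp measurable_snd)
  have key := Kernel.partialTraj_compProd_eq_map_traj (X := fun _ : ℕ => State)
    (κ := historyKernel p) (Nat.zero_le n) (x₀ := fun _ => x)
  have h1 : ∫⁻ z, g z.1 * f z.2 ∂((chainLaw p x).map
      (fun ω => (Preorder.frestrictLe (π := fun _ : ℕ => State) n ω, ω (n + 1)))) =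
      ∫⁻ ω, g (Preorder.frestrictLe n ω) * f (ω (n + 1)) ∂chainLaw p x :=
    lintegral_map hF (by fun_prop)
  rw [← h1, chainLaw, ← key, Measure.lintegral_compProd hF,
    ← Kernel.traj_map_frestrictLe_apply, lintegral_map]
  · refine lintegral_congr fun ω => ?_
    exact lintegral_const_mul (μ := (p (ω n)).toMeasure) (g (Preorder.frestrictLe n ω)) hf
  · exact Measurable.lintegral_kernel_prod_right' hF
  · fun_prop

theorem chainLaw_zero_ae (p : State → PMF State) (x : State) :
    ∀ᵐ ω ∂chainLaw p x, ω 0 = x := by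
  have h := Kernel.traj_map_frestrictLe_apply (X := fun _ : ℕ => State)
    (κ := historyKernel p) 0 0 (fun _ => x)
  rw [Kernel.partialTraj_self, Kernel.id_apply] at h
  have h2 : ∀ᵐ z ∂((chainLaw p x).map (Preorder.frestrictLe (π := fun _ : ℕ => State) 0)),
      z ⟨0, Finset.mem_Iic.2 le_rfl⟩ = x := by
    rw [chainLaw, h, ae_dirac_iff]
    exact measurableSet_eq_fun (measurable_pi_apply _) measurable_const
  exact ae_of_ae_map (by fun_prop) h2

/-! ### Hitting times -/

/-- The trajectories that do not visit `D` at the times `1, …, n`. -/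
def avoid (D : Set State) (n : ℕ) : Set (ℕ → State) := {ω | ∀ k, 1 ≤ k → k ≤ n → ω k ∉ D}

theorem measurableSet_avoid (D : Set State) (n : ℕ) : MeasurableSet (avoid D n) := by
  have : avoid D n = ⋂ k, ⋂ (_ : 1 ≤ k), ⋂ (_ : k ≤ n), (fun ω : ℕ → State => ω k) ⁻¹' Dᶜ := by
    ext ω; simp [avoid]
  rw [this]
  exact .iInter fun k => .iInter fun _ => .iInter fun _ =>
    measurable_pi_apply k (Set.to_countable _).measurableSet

theorem avoid_zero (D : Set State) : avoid D 0 = univ := by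
  ext ω; simp only [avoid, mem_ofPred_eq, mem_univ, iff_true]; omega

theorem mem_avoid_succ {D : Set State} {n : ℕ} {ω : ℕ → State} :
    ω ∈ avoid D (n + 1) ↔ ω ∈ avoid D n ∧ ω (n + 1) ∉ D := by
  constructor
  · exact fun h => ⟨fun k h1 h2 => h k h1 (by omega), h _ (by omega) le_rfl⟩
  · rintro ⟨h, h'⟩ k h1 h2
    rcases Nat.lt_or_ge n k with h3 | h3
    · obtain rfl : k = n + 1 := by omega
      exact h'
    · exact h k h1 h3

theorem hitTime_eq_top_iff {U : Set State} {ω : ℕ → State} :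
    hitTime U ω = ⊤ ↔ ∀ n, 1 ≤ n → ω n ∉ U := by
  simp only [hitTime, sInf_eq_top, mem_image, mem_ofPred_eq, forall_exists_index, and_imp]
  constructor
  · intro h n h1 h2
    exact ENat.natCast_ne_top n (h _ n h1 h2 rfl)
  · rintro h _ n h1 h2 -
    exact absurd h2 (h n h1)

theorem setOf_hitTime_eq_top (U : Set State) : {ω | hitTime U ω = ⊤} = ⋂ n, avoid U n := by
  ext ω
  simp only [mem_ofPred_eq, hitTime_eq_top_iff, mem_iInter, avoid]
  exact ⟨fun h _ k h1 _ => h k h1, fun h n h1 => h n n h1 le_rfl⟩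

theorem mem_avoid_of_lt_hitTime {U : Set State} {ω : ℕ → State} {n : ℕ}
    (h : (n : ℕ∞) < hitTime U ω) : ω ∈ avoid U n := by
  intro k h1 h2 h3
  have : hitTime U ω ≤ k := sInf_le ⟨k, ⟨h1, h3⟩, rfl⟩
  have h4 : (k : ℕ∞) ≤ n := by exact_mod_cast h2
  exact absurd (h.trans_le (this.trans h4)) (lt_irrefl _)

theorem hitTime_anti {U D : Set State} (h : D ⊆ U) (ω : ℕ → State) :
    hitTime U ω ≤ hitTime D ω :=
  sInf_le_sInf (image_mono fun _ hn => ⟨hn.1, h hn.2⟩)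

/-- This is the tail-sum formula for `T = ∑ 1{T > n}`. Testing it on finite `m ≤ hitTime U ω` also
covers an infinite hitting time. -/
theorem hitTime_le_tsum (U : Set State) (ω : ℕ → State) :
    (hitTime U ω : ℝ≥0∞) ≤ ∑' n, (avoid U n).indicator 1 ω := by
  have key : ∀ m : ℕ, (m : ℕ∞) ≤ hitTime U ω →
      (m : ℝ≥0∞) ≤ ∑' n, (avoid U n).indicator 1 ω := by
    intro m hm
    refine le_trans (le_of_eq ?_) (ENNReal.sum_le_tsum (Finset.range m))
    rw [Finset.sum_congr rfl (g := fun _ => (1 : ℝ≥0∞)) fun n hn => ?_]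
    · simp
    · have : ω ∈ avoid U n := mem_avoid_of_lt_hitTime
        (lt_of_lt_of_le (by exact_mod_cast Finset.mem_range.1 hn) hm)
      simp [this]
  rcases h : hitTime U ω with _ | m
  · refine le_of_eq (Eq.symm (ENNReal.eq_top_of_forall_nnreal_le fun r => ?_))
    obtain ⟨m, hm⟩ := exists_nat_ge r
    refine le_trans ?_ (key m (by rw [h]; exact le_top))
    exact_mod_cast hm
  · exact key m h.ge

/-! ### Lyapunov functions -/

/-- A function whose one-step mean drops by at least `c` outside `D` and which is at least `m`
on `D` controls the occupation of the complement of `D` and the probability of visiting `D`. -/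
theorem lyapunov_bound (p : State → PMF State) (D : Set State) (V : State → ℝ≥0∞) (c m : ℝ≥0∞)
    (hV : ∀ x, x ∉ D → ∫⁻ y, V y ∂(p x).toMeasure + c ≤ V x) (hm : ∀ x ∈ D, m ≤ V x)
    (x : State) (hx : x ∉ D) (n : ℕ) :
    ∫⁻ ω, (avoid D n).indicator 1 ω * V (ω n) ∂chainLaw p x
      + c * ∑ k ∈ Finset.range n, chainLaw p x (avoid D k)
      + m * chainLaw p x (avoid D n)ᶜ ≤ V x := by
  have mV : Measurable V := measurable_of_countable V
  induction n with
  | zero =>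
    have : ∫⁻ ω, (avoid D 0).indicator 1 ω * V (ω 0) ∂chainLaw p x = V x := by
      rw [lintegral_congr_ae (g := fun _ => V x)]
      · simp
      · filter_upwards [chainLaw_zero_ae p x] with ω hω
        simp [avoid_zero, hω]
    rw [this]; simp [avoid_zero]
  | succ n ih =>
    refine le_trans ?_ ih
    have mA := measurableSet_avoid D n
    have mA' := measurableSet_avoid D (n + 1)
    have mi : Measurable ((avoid D n).indicator (1 : (ℕ → State) → ℝ≥0∞)) :=
      measurable_one.indicator mA
    have mi' : Measurable ((avoid D (n + 1)).indicator (1 : (ℕ → State) → ℝ≥0∞)) :=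
      measurable_one.indicator mA'
    have hsub : avoid D (n + 1) ⊆ avoid D n := fun ω h => (mem_avoid_succ.1 h).1
    -- Paths entering `D` exactly at time `n + 1` have `V ≥ m` there; their mass moves to the third
    -- term of the bound.
    have h1 : ∫⁻ ω, (avoid D (n + 1)).indicator 1 ω * V (ω (n + 1)) ∂chainLaw p x
        + m * chainLaw p x (avoid D n \ avoid D (n + 1))
        ≤ ∫⁻ ω, (avoid D n).indicator 1 ω * V (ω (n + 1)) ∂chainLaw p x := by
      rw [← lintegral_indicator_const (mA.diff mA'), ← lintegral_add_left (by fun_prop)]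
      refine lintegral_mono fun ω => ?_
      by_cases hA' : ω ∈ avoid D (n + 1)
      · simp [hA', hsub hA']
      · by_cases hA : ω ∈ avoid D n
        · have : ω (n + 1) ∈ D := by
            by_contra h
            exact hA' (mem_avoid_succ.2 ⟨hA, h⟩)
          simp [hA, hA', hm _ this]
        · simp [hA, hA']
    have h2 : ∫⁻ ω, (avoid D n).indicator 1 ω * V (ω (n + 1)) ∂chainLaw p x
        = ∫⁻ ω, (avoid D n).indicator 1 ω * ∫⁻ y, V y ∂(p (ω n)).toMeasure ∂chainLaw p x := by
      -- The indicator of `avoid D n`, rewritten as a function of the history up to `n`.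
      let g : ((i : Finset.Iic n) → (fun _ : ℕ => State) i) → ℝ≥0∞ :=
        {z | ∀ k : Finset.Iic n, 1 ≤ k.1 → z k ∉ D}.indicator 1
      have hg : Measurable g := by
        refine measurable_one.indicator ?_
        have : {z : (i : Finset.Iic n) → (fun _ : ℕ => State) i |
            ∀ k : Finset.Iic n, 1 ≤ k.1 → z k ∉ D} =
            ⋂ k : Finset.Iic n, ⋂ (_ : 1 ≤ k.1), (fun z => z k) ⁻¹' Dᶜ := by
          ext; simp
        rw [this]
        exact .iInter fun k => .iInter fun _ =>
          measurable_pi_apply k (Set.to_countable _).measurableSet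
      have hgA : ∀ ω : ℕ → State,
          g (Preorder.frestrictLe (π := fun _ : ℕ => State) n ω) = (avoid D n).indicator 1 ω := by
        intro ω
        have : Preorder.frestrictLe (π := fun _ : ℕ => State) n ω ∈
            {z : (i : Finset.Iic n) → (fun _ : ℕ => State) i |
              ∀ k : Finset.Iic n, 1 ≤ k.1 → z k ∉ D} ↔ ω ∈ avoid D n :=
          ⟨fun h k h1 h2 => h ⟨k, Finset.mem_Iic.2 h2⟩ h1,
            fun h k h1 => h k.1 h1 (Finset.mem_Iic.1 k.2)⟩
        by_cases hω : ω ∈ avoid D n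
        · simp only [g, indicator_of_mem (this.2 hω), indicator_of_mem hω, Pi.one_apply]
        · simp only [g, indicator_of_notMem (mt this.1 hω), indicator_of_notMem hω]
      simpa only [hgA] using lintegral_chainLaw_succ p x n hg V
    have h3 : ∫⁻ ω, (avoid D n).indicator 1 ω * ∫⁻ y, V y ∂(p (ω n)).toMeasure ∂chainLaw p x
        + c * chainLaw p x (avoid D n)
        ≤ ∫⁻ ω, (avoid D n).indicator 1 ω * V (ω n) ∂chainLaw p x := by
      rw [← lintegral_indicator_const mA, ← lintegral_add_right _ (by fun_prop)]
      refine lintegral_mono_ae ?_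
      filter_upwards [chainLaw_zero_ae p x] with ω hω
      by_cases hA : ω ∈ avoid D n
      · have : ω n ∉ D := by
          -- `avoid` ignores time `0`, so there the start outside `D` is needed.
          rcases Nat.eq_zero_or_pos n with rfl | hn
          · rwa [hω]
          · exact hA n hn le_rfl
        simpa [hA] using hV _ this
      · simp [hA]
    have h4 : chainLaw p x (avoid D (n + 1))ᶜ
        = chainLaw p x (avoid D n \ avoid D (n + 1)) + chainLaw p x (avoid D n)ᶜ := by
      rw [← measure_union _ mA.compl]
      · congr 1
        ext ω
        simp only [mem_compl_iff, mem_union, mem_sdiff]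
        exact ⟨fun h => by tauto, fun h h' => by have := hsub h'; tauto⟩
      · exact disjoint_left.2 fun ω h h' => h' h.1
    rw [Finset.sum_range_succ, h4, mul_add, mul_add]
    calc _ = (∫⁻ ω, (avoid D (n + 1)).indicator 1 ω * V (ω (n + 1)) ∂chainLaw p x
        + m * chainLaw p x (avoid D n \ avoid D (n + 1))) + c * chainLaw p x (avoid D n)
        + c * ∑ k ∈ Finset.range n, chainLaw p x (avoid D k)
        + m * chainLaw p x (avoid D n)ᶜ := by ring
      _ ≤ _ := by gcongr; exact (add_le_add (h1.trans h2.le) le_rfl).trans h3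

theorem lintegral_hitTime_lt_top (p : State → PMF State) (D : Set State) (V : State → ℝ≥0∞)
    (c : ℝ≥0∞) (hc : c ≠ 0) (hc' : c ≠ ⊤)
    (hV : ∀ x, x ∉ D → ∫⁻ y, V y ∂(p x).toMeasure + c ≤ V x) (hV' : ∀ x, V x ≠ ⊤)
    (x : State) (hx : x ∉ D) :
    ∫⁻ ω, (hitTime D ω : ℝ≥0∞) ∂chainLaw p x < ⊤ := by
  have h1 : ∀ n, ∑ k ∈ Finset.range n, chainLaw p x (avoid D k) ≤ V x / c := by
    intro n
    rw [ENNReal.le_div_iff_mul_le (.inl hc) (.inl hc'), mul_comm]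
    have := lyapunov_bound p D V c 0 hV (fun _ _ => zero_le) x hx n
    exact (le_add_left le_rfl).trans (le_self_add.trans this)
  calc ∫⁻ ω, (hitTime D ω : ℝ≥0∞) ∂chainLaw p x
      ≤ ∫⁻ ω, ∑' n, (avoid D n).indicator 1 ω ∂chainLaw p x :=
        lintegral_mono fun ω => hitTime_le_tsum D ω
    _ = ∑' n, chainLaw p x (avoid D n) := by
        rw [lintegral_tsum fun n =>
          (measurable_one.indicator (measurableSet_avoid D n)).aemeasurable]
        exact tsum_congr fun n => lintegral_indicator_one (measurableSet_avoid D n)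
    _ ≤ V x / c := ENNReal.tsum_le_of_sum_range_le h1
    _ < ⊤ := ENNReal.div_lt_top (hV' x) hc

/-- The probability of having met `D` by time `n` is at most `V x < 1`, uniformly in `n`, and these
events increase to the event of ever meeting `D`. -/
theorem hitTime_eq_top_pos (p : State → PMF State) (D : Set State) (V : State → ℝ≥0∞)
    (hV : ∀ x, x ∉ D → ∫⁻ y, V y ∂(p x).toMeasure ≤ V x) (hD : ∀ x ∈ D, 1 ≤ V x)
    (x : State) (hx : x ∉ D) (hx1 : V x < 1) :
    0 < chainLaw p x {ω | hitTime D ω = ⊤} := by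
  have h1 : ∀ n, chainLaw p x (avoid D n)ᶜ ≤ V x := by
    intro n
    have := lyapunov_bound p D V 0 1 (by simpa using hV) hD x hx n
    rw [one_mul] at this
    exact (le_add_left le_rfl).trans this
  have hmono : Monotone fun n => (avoid D n)ᶜ :=
    monotone_nat_of_le_succ fun n => compl_subset_compl.2 fun ω h => (mem_avoid_succ.1 h).1
  have h2 : chainLaw p x {ω | hitTime D ω = ⊤}ᶜ ≤ V x := by
    rw [setOf_hitTime_eq_top, compl_iInter, hmono.measure_iUnion]
    exact iSup_le h1
  rw [pos_iff_ne_zero]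
  intro h0
  have h3 : chainLaw p x {ω | hitTime D ω = ⊤}ᶜ = 1 := by
    rw [prob_compl_eq_one_iff, h0]
    rw [setOf_hitTime_eq_top]
    exact .iInter fun n => measurableSet_avoid D n
  exact absurd (h3 ▸ h2) (not_le.2 hx1)

/-! ### Irreducibility -/

theorem chainLaw_apply_pos_of_reflTransGen (p : State → PMF State) {x y : State}
    (h : Relation.ReflTransGen (fun u v => v ∈ (p u).support) x y) :
    ∃ n, 0 < chainLaw p x {ω | ω n = y} := by
  induction h with
  | refl =>
    refine ⟨0, ?_⟩
    have : chainLaw p x {ω | ω 0 = x} = 1 :=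
      (prob_compl_eq_zero_iff (measurableSet_eq_fun (measurable_pi_apply _)
        measurable_const)).1 (ae_iff.1 (chainLaw_zero_ae p x))
    simp [this]
  | @tail u v _ huv ih =>
    obtain ⟨n, hn⟩ := ih
    refine ⟨n + 1, ?_⟩
    have hms : ∀ (k : ℕ) (z : State), MeasurableSet {ω : ℕ → State | ω k = z} := fun k z =>
      measurableSet_eq_fun (measurable_pi_apply _) measurable_const
    let g : ((i : Finset.Iic n) → (fun _ : ℕ => State) i) → ℝ≥0∞ :=
      fun z => ({u} : Set State).indicator 1 (z ⟨n, Finset.mem_Iic.2 le_rfl⟩)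
    have hg : Measurable g := (measurable_of_countable (({u} : Set State).indicator (1 : State → ℝ≥0∞))).comp
      (measurable_pi_apply (⟨n, Finset.mem_Iic.2 le_rfl⟩ : Finset.Iic n))
    have key := lintegral_chainLaw_succ p x n hg (({v} : Set State).indicator 1)
    have h1 : ∫⁻ ω, g (Preorder.frestrictLe n ω) * ({v} : Set State).indicator 1 (ω (n + 1))
        ∂chainLaw p x ≤ chainLaw p x {ω | ω (n + 1) = v} := by
      rw [← lintegral_indicator_one (hms _ _)]
      refine lintegral_mono fun ω => ?_
      by_cases hv : ω (n + 1) = v <;> by_cases hu : ω n = u <;> simp [g, hv, hu]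
    have h2 : chainLaw p x {ω | ω n = u} * p u v ≤
        ∫⁻ ω, g (Preorder.frestrictLe n ω) *
          ∫⁻ y, ({v} : Set State).indicator 1 y ∂(p (ω n)).toMeasure ∂chainLaw p x := by
      rw [mul_comm, ← lintegral_indicator_const (hms _ _)]
      refine lintegral_mono fun ω => ?_
      by_cases hu : ω n = u
      · have : ∫⁻ y, ({v} : Set State).indicator 1 y ∂(p u).toMeasure = p u v := by
          rw [lintegral_indicator_one (measurableSet_singleton v),
            PMF.toMeasure_apply_singleton _ _ (measurableSet_singleton v)]
        simp only [g, Preorder.frestrictLe_apply, hu, this]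
        simp [hu]
      · simp [hu]
    have h3 : 0 < chainLaw p x {ω | ω n = u} * p u v :=
      ENNReal.mul_pos hn.ne' ((PMF.mem_support_iff _ _).1 huv)
    exact h3.trans_le (h2.trans (key.symm.le.trans h1))

theorem isIrreducible_of_reflTransGen (p : State → PMF State)
    (h : ∀ x y, Relation.ReflTransGen (fun u v => v ∈ (p u).support) x y) :
    IsIrreducible p := by
  rintro U - ⟨y, hy⟩ x hx
  obtain ⟨n, hn⟩ := chainLaw_apply_pos_of_reflTransGen p (h x y)
  refine hn.trans_le (measure_mono_ae ?_)
  filter_upwards [chainLaw_zero_ae p x] with ω hω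
  intro hωn
  change ω n = y at hωn
  change hitTime U ω < ⊤
  rw [lt_top_iff_ne_top, Ne, hitTime_eq_top_iff]
  intro hno
  refine hno n (Nat.one_le_iff_ne_zero.2 ?_) (hωn ▸ hy)
  -- Hitting times start at `1`; the path of length `0` is excluded because `x ∉ U`.
  rintro rfl
  exact hx (hω ▸ hωn ▸ hy)

/-! ### The embedded chain of the queueing system -/

theorem Params.toReal_jumpLaw (L : Params) (a : Action) (x : State) (ξ : Step) :
    (L.jumpLaw a x ξ).toReal = L.rate a x ξ / L.totalRate a x :=
  ENNReal.toReal_ofReal (div_nonneg (L.rate_nonneg a x ξ) (L.totalRate_pos a x).le)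

theorem Params.jumpLaw_congr (L : Params) {a : Action} {x y : State}
    (h : L.rate a x = L.rate a y) : L.jumpLaw a x = L.jumpLaw a y := by
  have h' : L.totalRate a x = L.totalRate a y := by simp only [Params.totalRate, h]
  ext ξ
  change ENNReal.ofReal _ = ENNReal.ofReal _
  rw [h, h']

theorem Params.lintegral_transition (L : Params) (a : Action) (x : State) (f : State → ℝ≥0∞) :
    ∫⁻ y, f y ∂(L.transition a x).toMeasure = ∑ ξ, f (move x ξ) * L.jumpLaw a x ξ := by
  let _ : MeasurableSpace Step := ⊤
  have hm : Measurable (move x) := measurable_from_top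
  rw [Params.transition, ← PMF.toMeasure_map _ _ hm,
    lintegral_map (measurable_of_countable f) hm, lintegral_fintype]
  exact Finset.sum_congr rfl fun ξ _ => by
    rw [PMF.toMeasure_apply_singleton _ _ (measurableSet_singleton ξ)]

/-- The generator of the continuous-time chain, applied to the function `g`. -/
noncomputable def Params.gen (L : Params) (a : Action) (g : State → ℝ) (x : State) : ℝ :=
  ∑ ξ, L.rate a x ξ * (g (move x ξ) - g x)

theorem Params.lintegral_transition_add_le (L : Params) (a : Action) (g : State → ℝ)
    (hg : ∀ x, 0 ≤ g x) {c : ℝ} (hc : 0 ≤ c) (x : State)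
    (h : L.gen a g x + c * L.totalRate a x ≤ 0) :
    ∫⁻ y, ENNReal.ofReal (g y) ∂(L.transition a x).toMeasure + ENNReal.ofReal c
      ≤ ENNReal.ofReal (g x) := by
  have hT := L.totalRate_pos a x
  have h1 : ∫⁻ y, ENNReal.ofReal (g y) ∂(L.transition a x).toMeasure
      = ENNReal.ofReal (∑ ξ, g (move x ξ) * (L.rate a x ξ / L.totalRate a x)) := by
    rw [L.lintegral_transition, ENNReal.ofReal_sum_of_nonneg fun ξ _ =>
      mul_nonneg (hg _) (div_nonneg (L.rate_nonneg a x ξ) hT.le)]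
    exact Finset.sum_congr rfl fun ξ _ => (ENNReal.ofReal_mul (hg _)).symm
  rw [h1, ← ENNReal.ofReal_add _ hc]
  · refine ENNReal.ofReal_le_ofReal ?_
    have h2 : ∑ ξ, g (move x ξ) * (L.rate a x ξ / L.totalRate a x)
        = (L.gen a g x) / L.totalRate a x + g x := by
      have : L.gen a g x = ∑ ξ, g (move x ξ) * L.rate a x ξ - L.totalRate a x * g x := by
        rw [Params.gen, Params.totalRate, Finset.sum_mul, ← Finset.sum_sub_distrib]
        exact Finset.sum_congr rfl fun ξ _ => by ring
      rw [this, sub_div, mul_div_cancel_left₀ _ hT.ne', sub_add_cancel, Finset.sum_div]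
      exact Finset.sum_congr rfl fun ξ _ => by ring
    have h3 : L.gen a g x / L.totalRate a x + c ≤ 0 := by
      have : L.gen a g x / L.totalRate a x + c
          = (L.gen a g x + c * L.totalRate a x) / L.totalRate a x := by
        field_simp
      rw [this]
      exact div_nonpos_of_nonpos_of_nonneg h hT.le
    rw [h2]; linarith
  · exact Finset.sum_nonneg fun ξ _ =>
      mul_nonneg (hg _) (div_nonneg (L.rate_nonneg a x ξ) hT.le)

theorem Params.totalRate_le (L : Params) (a : Action) (x : State) :
    L.totalRate a x ≤ L.lam + L.mu1 + L.mu2 + L.muT := by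
  have h2 := L.mu1_pos
  have h3 := L.mu2_pos
  have h4 := L.muT_pos
  rw [Params.totalRate, Step.sum_eq]
  simp only [Params.rate]
  split_ifs <;> linarith

theorem Params.move_mem_support (L : Params) {a : Action} {x : State} {ξ : Step}
    (h : 0 < L.rate a x ξ) : move x ξ ∈ (L.transition a x).support := by
  rw [Params.transition, PMF.mem_support_map_iff]
  refine ⟨ξ, ?_, rfl⟩
  rw [PMF.mem_support_iff]
  exact (ENNReal.ofReal_pos.2 (div_pos h (L.totalRate_pos a x))).ne'

/-- Any two states communicate through the origin: services empty the queues, and arrivals, possible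
at both queues, fill them again. -/
theorem Params.isIrreducible_transition (L : Params) (a : Action) (h0 : 0 < L.prob a)
    (h1 : L.prob a < 1) : IsIrreducible (L.transition a) := by
  have hl := L.lam_pos
  have hm1 := L.mu1_pos
  have hm2 := L.mu2_pos
  have hmT := L.muT_pos
  refine isIrreducible_of_reflTransGen _ fun x y => ?_
  have down : ∀ i j : ℕ, Relation.ReflTransGen
      (fun u v => v ∈ (L.transition a u).support) (i, j) (0, 0) := by
    intro i j
    induction i with
    | succ i ih =>
      refine .head (L.move_mem_support (ξ := .ne1) (x := (i + 1, j)) ?_) ih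
      rw [Params.rate, if_neg (Nat.succ_ne_zero i)]
      split_ifs <;> assumption
    | zero =>
      induction j with
      | zero => exact .refl
      | succ j ih =>
        refine .head (L.move_mem_support (ξ := .ne2) (x := (0, j + 1)) ?_) ih
        simpa [Params.rate] using hmT
  have up : ∀ i j : ℕ, Relation.ReflTransGen
      (fun u v => v ∈ (L.transition a u).support) (0, 0) (i, j) := by
    intro i j
    induction i with
    | succ i ih =>
      exact ih.tail (L.move_mem_support (ξ := .e1) (x := (i, j)) (mul_pos hl h0))
    | zero =>
      induction j with
      | zero => exact .refl
      | succ j ih =>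
        exact ih.tail (L.move_mem_support (ξ := .e2) (x := (0, j)) (mul_pos hl (by linarith)))
  exact (down x.1 x.2).trans (up y.1 y.2)

/-! ### Transience -/

theorem exists_box_of_isBounded {U : Set State} (hU : Bornology.IsBounded U) :
    ∃ N : ℕ, ∀ x ∈ U, x.1 ≤ N ∧ x.2 ≤ N := by
  obtain ⟨r, hr⟩ := (Metric.isBounded_iff_subset_closedBall ((0, 0) : State)).1 hU
  refine ⟨⌈r⌉₊, fun x hx => ?_⟩
  have h := hr hx
  rw [Metric.mem_closedBall, Prod.dist_eq, max_le_iff, Nat.dist_eq, Nat.dist_eq] at h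
  have h' := Nat.le_ceil r
  simp only [Nat.cast_zero, sub_zero, Nat.abs_cast] at h
  exact ⟨by exact_mod_cast h.1.trans h', by exact_mod_cast h.2.trans h'⟩

/-- The set `D` below is the complement of a shifted open quadrant. It contains `U` and both axes,
so only interior rates enter the superharmonicity check. -/
theorem Params.isTransient_transition (L : Params) (a : Action)
    (h1 : L.mu1 < L.lam * L.prob a) (h2 : L.mu2 < L.lam * (1 - L.prob a)) :
    IsTransient (L.transition a) := by
  have hl := L.lam_pos
  have hm1 := L.mu1_pos
  have hm2 := L.mu2_pos
  refine ⟨L.isIrreducible_transition a (pos_of_mul_pos_right (hm1.trans h1) hl.le)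
    (by linarith [pos_of_mul_pos_right (hm2.trans h2) hl.le]), fun U hU => ?_⟩
  obtain ⟨N, hN⟩ := exists_box_of_isBounded hU
  -- For `s` above both ratios of service to arrival rate, each summand of `s ^ x₁ + s ^ x₂` has
  -- nonpositive drift.
  obtain ⟨s, hs, hs1⟩ : ∃ s : ℝ,
      max (L.mu1 / (L.lam * L.prob a)) (L.mu2 / (L.lam * (1 - L.prob a))) < s ∧ s < 1 :=
    exists_between (max_lt ((div_lt_one (hm1.trans h1)).2 h1) ((div_lt_one (hm2.trans h2)).2 h2))
  have hs2 := (le_max_left _ _).trans_lt hs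
  have hs3 := (le_max_right _ _).trans_lt hs
  have hs0 : 0 < s := (div_pos hm1 (hm1.trans h1)).trans hs2
  rw [div_lt_iff₀ (hm1.trans h1)] at hs2
  rw [div_lt_iff₀ (hm2.trans h2)] at hs3
  -- The normalized function equals `2 * s ^ (m + 1)` at the starting point, which must be below
  -- `1`.
  obtain ⟨m, hm⟩ := exists_pow_lt_of_lt_one (by norm_num : (0 : ℝ) < 1 / 2) hs1
  let g : State → ℝ := fun x => (s ^ x.1 + s ^ x.2) / s ^ N
  let D : Set State := {x | x.1 ≤ N ∨ x.2 ≤ N}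
  have hg : ∀ x, 0 ≤ g x := fun x => by positivity
  have hx : ((N + (m + 1), N + (m + 1)) : State) ∉ D := by
    simp only [D, mem_ofPred_eq]; omega
  have hUD : U ⊆ D := fun x hx => .inl (hN x hx).1
  refine ⟨(N + (m + 1), N + (m + 1)), fun h => hx (hUD h), ?_⟩
  refine (hitTime_eq_top_pos (L.transition a) D (fun x => ENNReal.ofReal (g x))
    ?_ ?_ _ hx ?_).trans_le (measure_mono fun ω hω => ?_)
  · rintro ⟨i, j⟩ hij
    obtain ⟨hi, hj⟩ : N < i ∧ N < j := by simpa [D] using hij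
    obtain ⟨i, rfl⟩ : ∃ k, i = k + 1 := ⟨i - 1, by omega⟩
    obtain ⟨j, rfl⟩ : ∃ k, j = k + 1 := ⟨j - 1, by omega⟩
    refine le_self_add.trans (L.lintegral_transition_add_le a g hg le_rfl _ ?_)
    have : L.gen a g (i + 1, j + 1) = (s ^ i * ((1 - s) * (L.mu1 - s * (L.lam * L.prob a)))
        + s ^ j * ((1 - s) * (L.mu2 - s * (L.lam * (1 - L.prob a))))) / s ^ N := by
      rw [Params.gen, Step.sum_eq]
      simp only [Params.rate, move, g, Nat.add_sub_cancel, Nat.add_eq_zero_iff, one_ne_zero,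
        and_false, if_false]
      field_simp
      ring
    rw [this, zero_mul, add_zero]
    refine div_nonpos_of_nonpos_of_nonneg (add_nonpos ?_ ?_) (by positivity)
    · exact mul_nonpos_of_nonneg_of_nonpos (by positivity)
        (mul_nonpos_of_nonneg_of_nonpos (by linarith) (by linarith))
    · exact mul_nonpos_of_nonneg_of_nonpos (by positivity)
        (mul_nonpos_of_nonneg_of_nonpos (by linarith) (by linarith))
  · intro x hx
    rw [ENNReal.one_le_ofReal]
    rw [one_le_div (by positivity)]
    have p1 : 0 < s ^ x.1 := by positivity
    have p2 : 0 < s ^ x.2 := by positivity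
    rcases hx with h | h
    · linarith [pow_le_pow_of_le_one hs0.le hs1.le h]
    · linarith [pow_le_pow_of_le_one hs0.le hs1.le h]
  · rw [ENNReal.ofReal_lt_one]
    have : g (N + (m + 1), N + (m + 1)) = 2 * s ^ (m + 1) := by
      simp only [g, pow_add]; field_simp; ring
    rw [this]
    have : s ^ (m + 1) ≤ s ^ m := pow_le_pow_of_le_one hs0.le hs1.le (Nat.le_succ m)
    linarith
  · have hω' : hitTime D ω = ⊤ := hω
    exact top_le_iff.1 (hω'.ge.trans (hitTime_anti hUD ω))

/-! ### Stability -/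

/-- A linear function with negative drift in the interior and on both axes. -/
theorem Params.exists_slope (L : Params) (a : Action) (h0 : L.mu1 + L.mu2 < L.lam)
    (h2 : L.lam * (1 - L.prob a) < L.mu2)
    (h3 : L.lam * (((L.mu1 + L.mu2) * L.prob a - L.mu1) /
      (L.mu2 - L.lam * (1 - L.prob a))) < L.muT) :
    ∃ b : ℝ, 1 ≤ b ∧ L.lam * L.prob a - L.mu1 + b * (L.lam * (1 - L.prob a) - L.mu2) < 0 ∧
      L.lam * L.prob a - L.muT + b * (L.lam * (1 - L.prob a)) < 0 ∧
      L.lam * L.prob a + b * (L.lam * (1 - L.prob a) - L.muT) < 0 := by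
  have hl := L.lam_pos
  have hT := L.muT_pos
  have hp := L.prob_nonneg a
  have hp1 := L.prob_le_one a
  have hd : 0 < L.mu2 - L.lam * (1 - L.prob a) := by linarith
  set p := L.prob a
  set d := L.mu2 - L.lam * (1 - p) with hd_def
  -- The slope at which the interior drift vanishes; it exceeds `1` because `μ₁ + μ₂ < λ`.
  set b₀ := (L.lam * p - L.mu1) / d with hb
  have hb0 : b₀ * d = L.lam * p - L.mu1 := div_mul_cancel₀ _ hd.ne'
  have hb1 : 1 < b₀ := by
    rw [hb, one_lt_div hd]; linarith
  have hkey : L.lam * (((L.mu1 + L.mu2) * p - L.mu1) / d)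
      = L.lam * p + b₀ * (L.lam * (1 - p)) := by
    rw [hb]; field_simp; rw [hd_def]; ring
  rw [hkey] at h3
  -- Raising the slope by `ε` makes the interior drift strictly negative and costs at most half the
  -- slack on the first axis.
  set ε := (L.muT - (L.lam * p + b₀ * (L.lam * (1 - p)))) / (2 * L.lam) with he
  have hε : 0 < ε := div_pos (by linarith) (by linarith)
  have hεl : 2 * (ε * L.lam) = L.muT - (L.lam * p + b₀ * (L.lam * (1 - p))) := by
    rw [he]; field_simp
  have h4 : ε * (L.lam * (1 - p)) ≤ ε * L.lam := by
    gcongr; nlinarith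
  have h5 : 0 < ε * L.lam := mul_pos hε hl
  have h6 : L.lam * p + (b₀ + ε) * (L.lam * (1 - p)) < L.muT := by linarith
  refine ⟨b₀ + ε, by linarith, ?_, by linarith, ?_⟩
  · have : 0 < ε * d := mul_pos hε hd
    have e : L.lam * (1 - p) - L.mu2 = -d := by rw [hd_def]; ring
    rw [e]; linarith
  -- The second axis follows from the first, since a service there gains `b * μ̃ ≥ μ̃`.
  · have : L.muT ≤ (b₀ + ε) * L.muT := le_mul_of_one_le_left hT.le (by linarith)
    linarith

theorem Params.gen_linear_le (L : Params) (a : Action) (b : ℝ)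
    (hb1 : L.lam * L.prob a - L.mu1 + b * (L.lam * (1 - L.prob a) - L.mu2) < 0)
    (hb2 : L.lam * L.prob a - L.muT + b * (L.lam * (1 - L.prob a)) < 0)
    (hb3 : L.lam * L.prob a + b * (L.lam * (1 - L.prob a) - L.muT) < 0) :
    ∃ δ > 0, ∀ x : State, x ≠ (0, 0) → L.gen a (fun x => (x.1 : ℝ) + b * x.2) x ≤ -δ := by
  refine ⟨min (min (-(L.lam * L.prob a - L.mu1 + b * (L.lam * (1 - L.prob a) - L.mu2)))
    (-(L.lam * L.prob a - L.muT + b * (L.lam * (1 - L.prob a)))))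
    (-(L.lam * L.prob a + b * (L.lam * (1 - L.prob a) - L.muT))),
    lt_min (lt_min (by linarith) (by linarith)) (by linarith), ?_⟩
  rintro ⟨i, j⟩ hij
  rw [le_neg, Params.gen, Step.sum_eq]
  rcases i with _ | i <;> rcases j with _ | j
  · exact absurd rfl hij
  · refine (min_le_right _ _).trans (le_of_eq ?_)
    simp [Params.rate, move]; ring
  · refine ((min_le_left _ _).trans (min_le_right _ _)).trans (le_of_eq ?_)
    simp [Params.rate, move]; ring
  · refine ((min_le_left _ _).trans (min_le_left _ _)).trans (le_of_eq ?_)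
    simp [Params.rate, move]; ring

/-- A bounded function supported on the box below `u` and growing fast towards `u`: it is
subharmonic away from `u`. -/
noncomputable def boxPow (R : ℝ) (u x : State) : ℝ :=
  if x.1 ≤ u.1 ∧ x.2 ≤ u.2 then R ^ (x.1 + x.2) else 0

theorem boxPow_nonneg {R : ℝ} (hR : 1 ≤ R) (u x : State) : 0 ≤ boxPow R u x := by
  unfold boxPow; split_ifs <;> positivity

theorem boxPow_le {R : ℝ} (hR : 1 ≤ R) (u x : State) : boxPow R u x ≤ R ^ (u.1 + u.2) := by
  unfold boxPow
  split_ifs with h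
  · exact pow_le_pow_right₀ hR (by omega)
  · positivity

theorem Params.le_gen_of_step (L : Params) (a : Action) (g : State → ℝ) (hg : ∀ x, 0 ≤ g x)
    (x : State) (η : Step) :
    L.rate a x η * g (move x η) - L.totalRate a x * g x ≤ L.gen a g x := by
  have h1 : L.gen a g x = ∑ ξ, L.rate a x ξ * g (move x ξ) - L.totalRate a x * g x := by
    rw [Params.gen, Params.totalRate, Finset.sum_mul, ← Finset.sum_sub_distrib]
    exact Finset.sum_congr rfl fun ξ _ => by ring
  rw [h1]
  gcongr
  exact Finset.single_le_sum (f := fun ξ => L.rate a x ξ * g (move x ξ))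
    (fun ξ _ => mul_nonneg (L.rate_nonneg a x ξ) (hg _)) (Finset.mem_univ η)

/-- Inside the box and away from `u`, some arrival stays in the box and multiplies the function by
`R`; for large `R` this single term outweighs the total exit rate. Outside the box the function
vanishes, so no step can decrease it. The origin always lies in the box. -/
theorem Params.exists_gen_boxPow (L : Params) (a : Action) (h0 : 0 < L.prob a)
    (h1 : L.prob a < 1) :
    ∃ R : ℝ, 1 ≤ R ∧ ∀ u x : State, x ≠ u → 0 ≤ L.gen a (boxPow R u) x ∧
      (x = (0, 0) → 1 ≤ L.gen a (boxPow R u) x) := by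
  have hl := L.lam_pos
  have hm1 := L.mu1_pos
  have hm2 := L.mu2_pos
  have hmT := L.muT_pos
  have hr1 : 0 < L.lam * L.prob a := mul_pos hl h0
  have hr2 : 0 < L.lam * (1 - L.prob a) := mul_pos hl (by linarith)
  set T := L.lam + L.mu1 + L.mu2 + L.muT with hT
  obtain ⟨R, hR⟩ : ∃ R : ℝ, max 1
      (max ((T + 1) / (L.lam * L.prob a)) ((T + 1) / (L.lam * (1 - L.prob a)))) ≤ R := ⟨_, le_rfl⟩
  simp only [max_le_iff, div_le_iff₀ hr1, div_le_iff₀ hr2] at hR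
  obtain ⟨hR1, hR2, hR3⟩ := hR
  refine ⟨R, hR1, fun u x hxu => ?_⟩
  have hpos := boxPow_nonneg hR1 u
  have up : ∀ η : Step, T + 1 ≤ R * L.rate a x η → x.1 ≤ u.1 → x.2 ≤ u.2 →
      boxPow R u (move x η) = R ^ (x.1 + x.2 + 1) → 1 ≤ L.gen a (boxPow R u) x := by
    intro η hη hx1 hx2 hφ
    refine le_trans ?_ (L.le_gen_of_step a _ hpos x η)
    have e : boxPow R u x = R ^ (x.1 + x.2) := if_pos ⟨hx1, hx2⟩
    rw [hφ, e, pow_succ]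
    have hone : 1 ≤ R ^ (x.1 + x.2) := one_le_pow₀ hR1
    have hle := L.totalRate_le a x
    nlinarith
  by_cases hbox : x.1 ≤ u.1 ∧ x.2 ≤ u.2
  · have : 1 ≤ L.gen a (boxPow R u) x := by
      by_cases hlt : x.1 < u.1
      · refine up .e1 hR2 hbox.1 hbox.2 ?_
        exact (if_pos ⟨hlt, hbox.2⟩).trans (by simp only [move]; ring)
      · have hlt2 : x.2 < u.2 := by
          by_contra h
          exact hxu (Prod.ext (by omega) (by omega))
        refine up .e2 hR3 hbox.1 hbox.2 ?_
        exact (if_pos ⟨hbox.1, hlt2⟩).trans (by simp only [move]; ring)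
    exact ⟨by linarith, fun _ => this⟩
  · refine ⟨?_, fun h => absurd (by subst h; simp) hbox⟩
    refine le_trans ?_ (L.le_gen_of_step a _ hpos x .e1)
    have e : boxPow R u x = 0 := if_neg hbox
    rw [e, mul_zero, sub_zero]
    exact mul_nonneg (L.rate_nonneg a x _) (hpos _)

theorem Params.isStable_transition (L : Params) (a : Action) (h0 : L.mu1 + L.mu2 < L.lam)
    (hp0 : 0 < L.prob a) (hp1 : L.prob a < 1)
    (h2 : L.lam * (1 - L.prob a) < L.mu2)
    (h3 : L.lam * (((L.mu1 + L.mu2) * L.prob a - L.mu1) /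
      (L.mu2 - L.lam * (1 - L.prob a))) < L.muT) :
    IsStable (L.transition a) := by
  refine ⟨L.isIrreducible_transition a hp0 hp1, ?_⟩
  rintro U - ⟨u, hu⟩ x hx
  have hm1 := L.mu1_pos
  have hm2 := L.mu2_pos
  have hmT := L.muT_pos
  have hl := L.lam_pos
  obtain ⟨b, hb, hb1, hb2, hb3⟩ := L.exists_slope a h0 h2 h3
  obtain ⟨δ, hδ, hlin⟩ := L.gen_linear_le a b hb1 hb2 hb3
  obtain ⟨R, hR, hbox⟩ := L.exists_gen_boxPow a hp0 hp1
  let h : State → ℝ := fun x => (x.1 : ℝ) + b * x.2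
  set T := L.lam + L.mu1 + L.mu2 + L.muT with hT
  have hTpos : 0 < T := by positivity
  -- Large enough for the unit gain of `boxPow` at the origin to bring the drift there down to `-δ`.
  set K := max 0 (L.gen a h (0, 0) + δ) with hK
  have hK0 : 0 ≤ K := le_max_left _ _
  -- The constant `R ^ (u.1 + u.2)` only keeps `g` nonnegative; the generator does not see it.
  let g : State → ℝ := fun x => h x + K * (R ^ (u.1 + u.2) - boxPow R u x)
  have hg : ∀ x, 0 ≤ g x := fun x => by
    have := sub_nonneg.2 (boxPow_le hR u x)
    have hb0 : 0 ≤ b := by linarith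
    positivity
  have hgen : ∀ x, L.gen a g x = L.gen a h x - K * L.gen a (boxPow R u) x := by
    intro x
    simp only [Params.gen]
    rw [Finset.mul_sum, ← Finset.sum_sub_distrib]
    exact Finset.sum_congr rfl fun ξ _ => by simp only [g]; ring
  have hdrift : ∀ x, x ≠ u → L.gen a g x ≤ -δ := by
    intro x hxu
    obtain ⟨hx0, hx1⟩ := hbox u x hxu
    rw [hgen]
    by_cases hx : x = (0, 0)
    · have e1 := hx1 hx
      have e2 : L.gen a h x + δ ≤ K := by rw [hx]; exact le_max_right _ _
      nlinarith
    · have e1 := hlin x hx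
      have e2 := mul_nonneg hK0 hx0
      have e3 : L.gen a h x ≤ -δ := e1
      linarith
  have hxu : x ∉ ({u} : Set State) := fun h => hx (h ▸ hu)
  refine (lintegral_mono fun ω => ?_).trans_lt
    (lintegral_hitTime_lt_top (L.transition a) {u} (fun x => ENNReal.ofReal (g x))
      (ENNReal.ofReal (δ / T)) (ENNReal.ofReal_pos.2 (div_pos hδ hTpos)).ne' ENNReal.ofReal_ne_top
      (fun y hy => L.lintegral_transition_add_le a g hg (div_pos hδ hTpos).le y ?_)
      (fun _ => ENNReal.ofReal_ne_top) x hxu)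
  · exact ENat.toENNReal_mono (hitTime_anti (singleton_subset_iff.2 hu) ω)
  · have e1 := hdrift y hy
    have e2 : δ / T * L.totalRate a y ≤ δ / T * T := by
      gcongr; exact L.totalRate_le a y
    rw [div_mul_cancel₀ _ hTpos.ne'] at e2
    linarith

/-! ### The conditions of the queueing model -/

/-- Truncated subtraction alters only steps of rate `0`; all other steps are true grid translations,
and distinct steps reach distinct points. -/
theorem Params.stepProb_transition (L : Params) (a : Action) (x : State) (ξ : Step) :
    stepProb L.transition a x ξ = L.jumpLaw a x ξ := by
  have hzero : ∀ η, L.rate a x η = 0 → L.jumpLaw a x η = 0 := fun η h => by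
    change ENNReal.ofReal _ = 0
    rw [h, zero_div, ENNReal.ofReal_zero]
  have hmove : ∀ η, L.rate a x η ≠ 0 →
      State.toGrid (move x η) = State.toGrid x + η.vec := by
    obtain ⟨i, j⟩ := x
    intro η h
    cases η
    · simp [State.toGrid, move, Step.vec]
    · rcases i with _ | i
      · simp [Params.rate] at h
      · simp [State.toGrid, move, Step.vec]
    · simp [State.toGrid, move, Step.vec]
    · rcases j with _ | j
      · simp [Params.rate] at h
      · simp [State.toGrid, move, Step.vec]
  have hinj : Function.Injective Step.vec := by
    intro s t h
    cases s <;> cases t <;> simp_all [Step.vec]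
  rw [stepProb, Params.transition, PMF.map_comp, PMF.map_apply, tsum_eq_single ξ]
  · by_cases h : L.rate a x ξ = 0
    · rw [hzero ξ h]; simp
    · exact if_pos (hmove ξ h).symm
  · intro η hη
    by_cases h : L.rate a x η = 0
    · rw [hzero η h]; simp
    · refine if_neg fun h2 => hη ?_
      rw [Function.comp_apply, hmove η h] at h2
      exact (hinj (add_left_cancel h2)).symm

theorem Params.inner_drift_jumpLaw (L : Params) (a : Action) (x : State)
    (v : EuclideanSpace ℝ (Fin 2)) :
    inner ℝ (drift (L.jumpLaw a x)) v = ((L.rate a x .e1 - L.rate a x .ne1) * v 0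
      + (L.rate a x .e2 - L.rate a x .ne2) * v 1) / L.totalRate a x := by
  simp only [drift, PiLp.inner_apply, Fin.sum_univ_two, L.toReal_jumpLaw]
  simp
  ring

theorem Params.isQueueingModel_transition (L : Params)
    (h1 : L.mu1 < L.lam * L.prob .red ∧ L.mu2 < L.lam * (1 - L.prob .red))
    (h2 : L.mu1 < L.lam * L.prob .green ∧ L.lam * (1 - L.prob .green) < L.mu2)
    (h3 : L.lam * (((L.mu1 + L.mu2) * L.prob .green - L.mu1) /
      (L.mu2 - L.lam * (1 - L.prob .green))) < L.muT)
    (h4 : L.mu2 < L.lam * ((L.lam * L.prob .red - L.mu1) * (L.prob .green - L.prob .red)) /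
        (L.lam + L.mu1 + L.mu2) + L.lam * (1 - L.prob .green)) :
    IsQueueingModel L.transition := by
  have hl := L.lam_pos
  have hm1 := L.mu1_pos
  have hm2 := L.mu2_pos
  have hrates : ∀ a, L.totalRate a (1, 1) = L.lam + L.mu1 + L.mu2 := fun a => by
    rw [Params.totalRate, Step.sum_eq]; simp [Params.rate]; ring
  have hs : 0 < L.lam + L.mu1 + L.mu2 := by positivity
  have hpp : 0 < L.lam * (L.prob .green - L.prob .red) := by linarith [h1.2, h2.2]
  have hpp' : 0 < L.prob .green - L.prob .red := pos_of_mul_pos_right hpp hl.le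
  refine ⟨fun a => L.jumpLaw a (1, 1), fun a => L.jumpLaw a (1, 0), fun a => L.jumpLaw a (0, 1),
    ?_, ?_, ?_, ?_, ?_, ?_⟩
  · intro a x ξ hx1 hx2
    rw [L.stepProb_transition, L.jumpLaw_congr (y := (1, 1))]
    ext η; cases η <;> simp [Params.rate, hx1.ne', hx2.ne']
  · intro a x ξ hx1 hx2
    rw [L.stepProb_transition, L.jumpLaw_congr (y := (1, 0))]
    ext η; cases η <;> simp [Params.rate, hx1.ne', hx2]
  · intro a x ξ hx1 hx2
    rw [L.stepProb_transition, L.jumpLaw_congr (y := (0, 1))]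
    ext η; cases η <;> simp [Params.rate, hx1, hx2.ne']
  · intro a
    rw [L.stepProb_transition, L.stepProb_transition]
    have h := (L.jumpLaw a (0, 0)).tsum_coe
    rw [tsum_fintype, Step.sum_eq] at h
    have e1 : L.jumpLaw a (0, 0) .ne1 = 0 := by
      change ENNReal.ofReal _ = 0; simp [Params.rate]
    have e2 : L.jumpLaw a (0, 0) .ne2 = 0 := by
      change ENNReal.ofReal _ = 0; simp [Params.rate]
    simpa [e1, e2] using h
  · obtain ⟨b, hb, hb1, hb2, hb3⟩ := L.exists_slope .green (by linarith [h1.1, h1.2]) h2.2 h3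
    refine ⟨!₂[1, b], ⟨by simp, by simp; linarith⟩, ?_, ?_, ?_⟩
    all_goals
      rw [L.inner_drift_jumpLaw]
      refine div_neg_of_neg_of_pos ?_ (L.totalRate_pos _ _)
      simp [Params.rate]
      linarith
  · have hϱ : ∀ a, inner ℝ (drift (L.jumpLaw a (1, 1))) (!₂[1, 0] : EuclideanSpace ℝ (Fin 2))
        = (L.lam * L.prob a - L.mu1) / (L.lam + L.mu1 + L.mu2) := fun a => by
      rw [L.inner_drift_jumpLaw, hrates]; simp [Params.rate]
    have hα0 : 0 < (L.mu2 - L.lam * (1 - L.prob .green)) /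
        (L.lam * (L.prob .green - L.prob .red)) := div_pos (by linarith [h2.2]) hpp
    have hα1 : (L.mu2 - L.lam * (1 - L.prob .green)) /
        (L.lam * (L.prob .green - L.prob .red)) < 1 := by
      rw [div_lt_one hpp]; linarith [h1.2]
    -- This `α₀` is the weight of red at which the second coordinate of the mixed drift vanishes;
    -- the first coordinate is positive for both actions.
    refine ⟨!₂[1, 0], _, by simp [EuclideanSpace.norm_eq], rfl, ?_,
      (L.mu2 - L.lam * (1 - L.prob .green)) / (L.lam * (L.prob .green - L.prob .red)), 1,
      hα0, hα1, le_rfl, ?_, ?_⟩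
    · rw [hϱ, hϱ]
      exact lt_min (div_pos (by linarith [h1.1]) hs) (div_pos (by linarith [h2.1]) hs)
    · rintro δ ⟨hδ, hδ1⟩
      rw [div_lt_iff₀ hpp] at hδ
      constructor
      · have : (δ • drift (L.jumpLaw .red (1, 1)) +
            (1 - δ) • drift (L.jumpLaw .green (1, 1)) : EuclideanSpace ℝ (Fin 2)) 0 =
            (δ * (L.lam * L.prob .red - L.mu1) + (1 - δ) * (L.lam * L.prob .green - L.mu1)) /
              (L.lam + L.mu1 + L.mu2) := by
          simp [drift, L.toReal_jumpLaw, hrates, Params.rate]; ring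
        rw [this]
        have hδ0 : 0 < δ := by
          by_contra hn
          nlinarith [h2.2]
        exact div_nonneg (add_nonneg (mul_nonneg hδ0.le (by linarith [h1.1]))
          (mul_nonneg (by linarith) (by linarith [h2.1]))) hs.le
      · have : (δ • drift (L.jumpLaw .red (1, 1)) +
            (1 - δ) • drift (L.jumpLaw .green (1, 1)) : EuclideanSpace ℝ (Fin 2)) 1 =
            (δ * (L.lam * (L.prob .green - L.prob .red))
              - (L.mu2 - L.lam * (1 - L.prob .green))) / (L.lam + L.mu1 + L.mu2) := by
          simp [drift, L.toReal_jumpLaw, hrates, Params.rate]; ring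
        rw [this]
        exact div_nonneg (by linarith) hs.le
    -- Since `p_r < p_g`, the minimum `ϱ` is the red drift, and `α₀ < ϱ` is (4) after clearing
    -- denominators.
    · rw [hϱ, hϱ, min_eq_left (by gcongr; linarith), sub_self, sub_pos, div_lt_div_iff₀ hpp hs]
      have h5 : L.mu2 - L.lam * (1 - L.prob .green) <
          L.lam * ((L.lam * L.prob .red - L.mu1) * (L.prob .green - L.prob .red)) /
          (L.lam + L.mu1 + L.mu2) := by linarith
      rw [lt_div_iff₀ hs] at h5
      linarith

end LoadBalancing

theorem mainTheorem9 (L : LoadBalancing.Params)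
    (h1 : L.mu1 < L.lam * L.prob .red ∧ L.mu2 < L.lam * (1 - L.prob .red))
    (h2 : L.mu1 < L.lam * L.prob .green ∧ L.lam * (1 - L.prob .green) < L.mu2)
    (h3 : L.lam * (((L.mu1 + L.mu2) * L.prob .green - L.mu1) /
      (L.mu2 - L.lam * (1 - L.prob .green))) < L.muT) :
    (L.mu2 < L.lam * ((L.lam * L.prob .red - L.mu1) * (L.prob .green - L.prob .red)) /
        (L.lam + L.mu1 + L.mu2) + L.lam * (1 - L.prob .green) →
      LoadBalancing.IsQueueingModel L.transition) ∧
    (L.prob .green < 1 → LoadBalancing.IsStable (L.transition .green)) ∧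
    LoadBalancing.IsTransient (L.transition .red) :=
  ⟨L.isQueueingModel_transition h1 h2 h3,
    fun hp => L.isStable_transition .green (by linarith [h1.1, h1.2])
      (pos_of_mul_pos_right (L.mu1_pos.trans h2.1) L.lam_pos.le) hp h2.2 h3,
    L.isTransient_transition .red h1.1 h1.2⟩
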